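/- Let $V$ be a finite set and let $D_L=(V,L)$ be a finite digraph (parallel edges are allowed). An edge enters $Z\subseteq V$ if its head is in $Z$ and its tail is in $V\setminus Z$. For $X\subseteq L$ and $Z\subseteq V$ let $\varrho_X(Z)$ be the number of edges in $X$ entering $Z$, and for a family $\mathcal F$ of subsets of $V$ let $\varrho_L(\mathcal F)$ be the number of edges in $L$ entering at least one member of $\mathcal F$. Let $p:2^V\to\mathbf Z\cup\{-\infty\}$ be an intersecting supermodular function, that is, $p(X)+p(Y)\le p(X\cap Y)+p(X\cup Y)$ for all $X,Y\subseteq V$ with $X\cap Y\neq\emptyset$. A set $X\subseteq L$ covers $p$ if $\varrho_X(Z)\ge p(Z)$ for every $Z\subseteq V$. Assume that $L$ covers $p$. Then the minimum number of edges of a subset of $L$ covering $p$ is equal to $$\max\Big\{\varrho_L(\mathcal F)-\sum_{Z\in\mathcal F}\big(\varrho_L(Z)-p(Z)\big)\Big\},$$ where the maximum is taken over all laminar families $\mathcal F$ of subsets $Z$ of $V$ with $p(Z)>-\infty$ (a family of distinct sets is laminar if any two of its members are disjoint or one contains the other; the empty family is allowed). Moreover, if $p$ is fully supermodular, that is, if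 the above inequality holds for all $X,Y\subseteq V$, then the maximum is attained by a family that is a chain $V_1\supset V_2\supset\cdots\supset V_q$ of subsets of $V$ (with $q\ge 0$). -/

import Mathlib

/-- A directed graph with node set `V` and edge set `E`; parallel edges and loops are allowed. -/
structure MultiDigraph (V E : Type*) where
  /-- The node that an edge leaves. -/
  tail : E → V
  /-- The node that an edge points to. -/
  head : E → V

namespace MultiDigraph

variable {V E : Type*} [DecidableEq V]

/-- The edge `e` enters `Z` if its head is in `Z` and its tail is not. -/
def Enters (D : MultiDigraph V E) (e : E) (Z : Finset V) : Prop :=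
  D.tail e ∉ Z ∧ D.head e ∈ Z

instance (D : MultiDigraph V E) (e : E) (Z : Finset V) : Decidable (D.Enters e Z) :=
  inferInstanceAs (Decidable (D.tail e ∉ Z ∧ D.head e ∈ Z))

/-- The number of edges in `X` that enter `Z` (the in-degree of `Z` in the subgraph `(V, X)`). -/
def inDegree (D : MultiDigraph V E) (X : Finset E) (Z : Finset V) : ℕ :=
  (X.filter fun e => D.Enters e Z).card

/-- The number of edges in `X` that enter at least one member of the family `F`. -/
def familyInDegree (D : MultiDigraph V E) (X : Finset E) (F : Finset (Finset V)) : ℕ :=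
  (X.filter fun e => ∃ Z ∈ F, D.Enters e Z).card

/-- The edge set `X` covers `p` if `p Z` is at most the in-degree of `Z` in `(V, X)`,
for every set `Z` of nodes. -/
def Covers (D : MultiDigraph V E) (X : Finset E) (p : Finset V → WithBot ℤ) : Prop :=
  ∀ Z : Finset V, p Z ≤ ((D.inDegree X Z : ℤ) : WithBot ℤ)

/-- The number of edges entering at least one member of `F`, minus the sum over `Z ∈ F` of the
difference of the in-degree of `Z` and `p Z`. It is used only for families `F` all of whose
members have a finite `p`-value, so that the default value `0` for `⊥` plays no role. -/
def familyValue [Fintype E] (D : MultiDigraph V E) (p : Finset V → WithBot ℤ)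
    (F : Finset (Finset V)) : ℤ :=
  (D.familyInDegree Finset.univ F : ℤ)
    - ∑ Z ∈ F, ((D.inDegree Finset.univ Z : ℤ) - (p Z).unbotD 0)

end MultiDigraph

/-- The supermodular inequality for all pairs of sets with nonempty intersection. -/
def IntersectingSupermodular {V : Type*} [DecidableEq V] (p : Finset V → WithBot ℤ) : Prop :=
  ∀ X Y : Finset V, (X ∩ Y).Nonempty → p X + p Y ≤ p (X ∩ Y) + p (X ∪ Y)

/-- The supermodular inequality for all pairs of sets. -/
def FullySupermodular {V : Type*} [DecidableEq V] (p : Finset V → WithBot ℤ) : Prop :=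
  ∀ X Y : Finset V, p X + p Y ≤ p (X ∩ Y) + p (X ∪ Y)

/-- A family of sets is laminar if any two members are disjoint or comparable. -/
def LaminarFamily {V : Type*} (F : Finset (Finset V)) : Prop :=
  ∀ X ∈ F, ∀ Y ∈ F, X ⊆ Y ∨ Y ⊆ X ∨ Disjoint X Y

/-!
The theorem is linear programming duality for the system `x(δ⁻(Z)) ≥ p(Z)`, `0 ≤ x ≤ 1`, with
integral solutions on both sides. The dual solutions are finite multisets `y` of sets `Z` with
`p Z ≠ ⊥`; if `y(e)` is the number of members of `y` entered by the edge `e`, the dual objective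
is `∑_{Z ∈ y} p Z - ∑_{e ∈ L} (y(e) - 1)⁺` (`MultiDigraph.dualValue`). Two operations on dual
solutions carry the proof.

* Uncrossing (`exists_uncrossed`): replacing two crossing members `X`, `Y` by `X ∩ Y`, `X ∪ Y`
  does not decrease `∑ p` and does not increase any `y(e)`, so every `y` can be made laminar, and
  a chain if `p` is fully supermodular.
* Equitable splitting (`exists_even_split`): the members of a laminar `y` that contain the head of
  `e` form a chain, and those entered by `e` are consecutive in it. Distributing the members
  according to the parity of their depth splits `y` into `z₀ + z₁` such that `z₀(e)` and `z₁(e)`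
  differ by at most one for every edge `e`.

Together they say that `y ↦ dualValue y` is discretely midpoint concave
(`exists_balanced_pair`). The minimum cover and an optimal dual solution are then found by
induction on the edge set `L` (`exists_cover_le_dualValue`): an edge `e` is either deleted, or
forced into the cover, which amounts to decreasing `p` by one on the sets entered by `e`. Forcing
`e` gives a cover of size `d + 1` and a dual solution `y₁`, which is good enough unless `y₁(e) = 0`
and its value is only `d`. In that case, if there is a dual solution `y₀` of value greater than `d`
for the edge set without `e`, then balancing `y₁` against such a `y₀` with `y₀(e)` minimal yields one
with `y₀(e) ≤ 1`, whose value is the same for `L` (`exists_dualValue_insert_lt`). If there is none,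
then `e` can be deleted and `y₁` is optimal.

Finally, repeated members of `y` can be discarded because the full edge set covers `p`.
-/

/-! ### Uncrossing -/

section Uncrossing

variable {V E : Type*} [DecidableEq V]

/-- The integer valued function `q` on the set system `S` satisfies the supermodular inequality for
all pairs of members of `S` that are not related by `C`; this includes that the intersection and
the union of such a pair belong to `S`. -/
def UncrossableOn (C : Finset V → Finset V → Prop) (S : Set (Finset V)) (q : Finset V → ℤ) :
    Prop :=
  ∀ X ∈ S, ∀ Y ∈ S, ¬ C X Y → X ∩ Y ∈ S ∧ X ∪ Y ∈ S ∧ q X + q Y ≤ q (X ∩ Y) + q (X ∪ Y)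

/-- The relation required of any two members of a laminar family. -/
def NonCrossing (X Y : Finset V) : Prop :=
  X ⊆ Y ∨ Y ⊆ X ∨ Disjoint X Y

/-- The number of members of the multiset `y` that the edge `e` enters. -/
def MultiDigraph.enterCount (D : MultiDigraph V E) (y : Multiset (Finset V)) (e : E) : ℕ :=
  y.countP (D.Enters e)

theorem MultiDigraph.enters_inter_union (D : MultiDigraph V E) (e : E) (X Y : Finset V) :
    (if D.Enters e (X ∩ Y) then 1 else 0) + (if D.Enters e (X ∪ Y) then 1 else 0) ≤
      (if D.Enters e X then 1 else 0) + (if D.Enters e Y then 1 else 0) := by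
  by_cases h1 : D.tail e ∈ X <;> by_cases h2 : D.tail e ∈ Y <;>
    by_cases h3 : D.head e ∈ X <;> by_cases h4 : D.head e ∈ Y <;>
    simp [Enters, h1, h2, h3, h4]

theorem card_mul_card_compl_uncross [Fintype V] {X Y : Finset V} (hXY : ¬ X ⊆ Y)
    (hYX : ¬ Y ⊆ X) :
    (X ∩ Y).card * (X ∩ Y)ᶜ.card + (X ∪ Y).card * (X ∪ Y)ᶜ.card <
      X.card * Xᶜ.card + Y.card * Yᶜ.card := by
  have ha : 0 < (X \ Y).card := Finset.card_pos.2 (Finset.sdiff_nonempty.2 hXY)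
  have hb : 0 < (Y \ X).card := Finset.card_pos.2 (Finset.sdiff_nonempty.2 hYX)
  have h1 := Finset.card_sdiff_add_card_inter X Y
  have h2 := Finset.card_sdiff_add_card_inter Y X
  rw [Finset.inter_comm] at h2
  have h3 := Finset.card_union_add_card_inter X Y
  have h4 := Finset.card_add_card_compl X
  have h5 := Finset.card_add_card_compl Y
  have h6 := Finset.card_add_card_compl (X ∩ Y)
  have h7 := Finset.card_add_card_compl (X ∪ Y)
  generalize (X \ Y).card = a at *
  generalize (Y \ X).card = b at *
  generalize (X ∩ Y).card = i at *
  generalize (X ∪ Y)ᶜ.card = c at *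
  have e1 : Xᶜ.card = b + c := by omega
  have e2 : Yᶜ.card = a + c := by omega
  have e3 : (X ∩ Y)ᶜ.card = a + b + c := by omega
  have e4 : (X ∪ Y).card = a + b + i := by omega
  rw [e1, e2, e3, e4, ← h1, ← h2]
  nlinarith [mul_pos ha hb]

/-- Every multiset can be uncrossed without decreasing its `q`-sum and without increasing the
number of members entered by any edge. -/
theorem exists_uncrossed [Fintype V] (D : MultiDigraph V E) {C : Finset V → Finset V → Prop}
    (hC : ∀ X Y, X ⊆ Y ∨ Y ⊆ X → C X Y) {S : Set (Finset V)} {q : Finset V → ℤ}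
    (hq : UncrossableOn C S q) (y : Multiset (Finset V)) (hy : ∀ Z ∈ y, Z ∈ S) :
    ∃ z : Multiset (Finset V), (∀ Z ∈ z, Z ∈ S) ∧ (∀ X ∈ z, ∀ Y ∈ z, C X Y) ∧
      (y.map q).sum ≤ (z.map q).sum ∧ ∀ e, D.enterCount z e ≤ D.enterCount y e := by
  -- The sum of `|Z| * |Zᶜ|` over the members strictly decreases with every uncrossing step.
  induction hn : (y.map fun Z => Z.card * Zᶜ.card).sum using Nat.strong_induction_on
    generalizing y with
  | _ n ih =>
    by_cases hgood : ∀ X ∈ y, ∀ Y ∈ y, C X Y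
    · exact ⟨y, hy, hgood, le_rfl, fun _ => le_rfl⟩
    push Not at hgood
    obtain ⟨X, hX, Y, hY, hXY⟩ := hgood
    have h1 : ¬ X ⊆ Y := fun h => hXY (hC _ _ (Or.inl h))
    have h2 : ¬ Y ⊆ X := fun h => hXY (hC _ _ (Or.inr h))
    obtain ⟨hI, hU, hle⟩ := hq X (hy X hX) Y (hy Y hY) hXY
    obtain ⟨t, rfl⟩ := Multiset.exists_cons_of_mem hX
    have hYt : Y ∈ t := (Multiset.mem_cons.1 hY).resolve_left fun h => h2 h.subset
    obtain ⟨t, rfl⟩ := Multiset.exists_cons_of_mem hYt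
    have hlt := card_mul_card_compl_uncross h1 h2
    obtain ⟨z, hzS, hzC, hzq, hze⟩ := ih _ (by
      rw [← hn]
      show (((X ∩ Y) ::ₘ (X ∪ Y) ::ₘ t).map fun Z => Z.card * Zᶜ.card).sum < _
      simp only [Multiset.map_cons, Multiset.sum_cons]
      omega) ((X ∩ Y) ::ₘ (X ∪ Y) ::ₘ t) (by
        simp only [Multiset.mem_cons] at hy ⊢
        rintro Z (rfl | rfl | hZ)
        · exact hI
        · exact hU
        · exact hy Z (Or.inr (Or.inr hZ))) rfl
    refine ⟨z, hzS, hzC, le_trans ?_ hzq, fun e => (hze e).trans ?_⟩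
    · simp only [Multiset.map_cons, Multiset.sum_cons]
      linarith
    · have := D.enters_inter_union e X Y
      simp only [MultiDigraph.enterCount, Multiset.countP_cons]
      omega

end Uncrossing

/-! ### Equitable splitting of laminar multisets -/

section Splitting

variable {V E : Type*} [DecidableEq V]

/-- A laminar multiset splits into two parts such that, for each nonempty `W`, the members
containing `W` are distributed evenly, the first part receiving the odd one. Members are inserted
by decreasing cardinality, so that the parts correspond to the parity of the depth. -/
theorem exists_even_split_superset (y : Multiset (Finset V))
    (hy : ∀ X ∈ y, ∀ Y ∈ y, NonCrossing X Y) :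
    ∃ z₀ z₁ : Multiset (Finset V), z₀ + z₁ = y ∧ ∀ W : Finset V, W.Nonempty →
      z₀.countP (W ⊆ ·) = (y.countP (W ⊆ ·) + 1) / 2 := by
  induction hn : y.card generalizing y with
  | zero =>
    obtain rfl := Multiset.card_eq_zero.1 hn
    exact ⟨0, 0, rfl, fun W _ => by simp⟩
  | succ n ih =>
    have hne : y.toFinset.Nonempty := by
      rw [Multiset.toFinset_nonempty]
      rintro rfl
      simp at hn
    obtain ⟨A, hA, hmin⟩ := y.toFinset.exists_min_image Finset.card hne
    rw [Multiset.mem_toFinset] at hA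
    obtain ⟨t, rfl⟩ := Multiset.exists_cons_of_mem hA
    obtain ⟨z₀, z₁, rfl, hz⟩ := ih t
      (fun X hX Y hY => hy X (Multiset.mem_cons_of_mem hX) Y (Multiset.mem_cons_of_mem hY))
      (by simpa using hn)
    -- A member that meets `A` contains `A`, because `A` has minimum cardinality.
    have hkey : ∀ W : Finset V, W.Nonempty → W ⊆ A →
        (z₀ + z₁).countP (W ⊆ ·) = (z₀ + z₁).countP (A ⊆ ·) := by
      intro W hW hWA
      refine Multiset.countP_congr rfl fun B hB => ?_
      have hBA := hmin B (Multiset.mem_toFinset.2 (Multiset.mem_cons_of_mem hB))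
      refine propext ⟨fun hWB => ?_, fun h => hWA.trans h⟩
      rcases hy A hA B (Multiset.mem_cons_of_mem hB) with h | h | h
      · exact h
      · exact (Finset.eq_of_subset_of_card_le h hBA).symm.subset
      · obtain ⟨w, hw⟩ := hW
        exact absurd (hWB hw) (Finset.disjoint_left.1 h (hWA hw))
    by_cases hpar : Even ((z₀ + z₁).countP (A ⊆ ·))
    · refine ⟨A ::ₘ z₀, z₁, by simp, fun W hW => ?_⟩
      have := hz W hW
      rw [Multiset.countP_cons, Multiset.countP_cons]
      split_ifs with hWA
      · rw [← hkey W hW hWA] at hpar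
        obtain ⟨m, hm⟩ := hpar
        omega
      · simpa using this
    · refine ⟨z₀, A ::ₘ z₁, by simp, fun W hW => ?_⟩
      have := hz W hW
      rw [Multiset.countP_cons]
      split_ifs with hWA
      · rw [← hkey W hW hWA, Nat.not_even_iff_odd] at hpar
        obtain ⟨m, hm⟩ := hpar
        omega
      · simpa using this

/-- The members entered by `e` are those that contain the head but not both ends of `e`. -/
theorem MultiDigraph.enterCount_add_countP (D : MultiDigraph V E) (y : Multiset (Finset V))
    (e : E) :
    D.enterCount y e + y.countP ({D.tail e, D.head e} ⊆ ·) = y.countP ({D.head e} ⊆ ·) := by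
  induction y using Multiset.induction_on with
  | empty => simp [enterCount]
  | cons A t ih =>
    simp only [enterCount, Multiset.countP_cons] at ih ⊢
    rw [← ih]
    by_cases h1 : D.tail e ∈ A <;> by_cases h2 : D.head e ∈ A <;>
      simp [Enters, Finset.insert_subset_iff, h1, h2] <;> omega

theorem exists_even_split (D : MultiDigraph V E) (y : Multiset (Finset V))
    (hy : ∀ X ∈ y, ∀ Y ∈ y, NonCrossing X Y) :
    ∃ z₀ z₁ : Multiset (Finset V), z₀ + z₁ = y ∧ ∀ e,
      D.enterCount z₀ e + D.enterCount z₁ e = D.enterCount y e ∧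
      D.enterCount z₀ e ≤ D.enterCount z₁ e + 1 ∧ D.enterCount z₁ e ≤ D.enterCount z₀ e + 1 := by
  obtain ⟨z₀, z₁, rfl, hz⟩ := exists_even_split_superset y hy
  refine ⟨z₀, z₁, rfl, fun e => ?_⟩
  have hadd : D.enterCount (z₀ + z₁) e = D.enterCount z₀ e + D.enterCount z₁ e :=
    Multiset.countP_add _ _ _
  have h1 := hz {D.head e} (Finset.singleton_nonempty _)
  have h2 := hz {D.tail e, D.head e} (Finset.insert_nonempty _ _)
  have h3 := D.enterCount_add_countP z₀ e
  have h4 := D.enterCount_add_countP (z₀ + z₁) e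
  omega

end Splitting

/-! ### Dual solutions -/

namespace MultiDigraph

variable {V E : Type*} [DecidableEq V]

/-- The objective value of the multiset `y` as a dual solution for the edge set `L`. The
subtraction of natural numbers is truncated: an edge entering no member of `y` costs nothing. -/
def dualValue (D : MultiDigraph V E) (L : Finset E) (q : Finset V → ℤ)
    (y : Multiset (Finset V)) : ℤ :=
  (y.map q).sum - ∑ e ∈ L, ((D.enterCount y e - 1 : ℕ) : ℤ)

theorem enterCount_cons (D : MultiDigraph V E) (A : Finset V) (y : Multiset (Finset V)) (e : E) :
    D.enterCount (A ::ₘ y) e = D.enterCount y e + if D.Enters e A then 1 else 0 :=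
  Multiset.countP_cons _ _ _

theorem inDegree_eq_sum (D : MultiDigraph V E) (L : Finset E) (Z : Finset V) :
    (D.inDegree L Z : ℤ) = ∑ e ∈ L, if D.Enters e Z then 1 else 0 := by
  simp [inDegree]

theorem dualValue_mono {q : Finset V → ℤ} {y : Multiset (Finset V)}
    {D : MultiDigraph V E} {z : Multiset (Finset V)} (L : Finset E)
    (hq : (y.map q).sum ≤ (z.map q).sum) (he : ∀ e, D.enterCount z e ≤ D.enterCount y e) :
    D.dualValue L q y ≤ D.dualValue L q z := by
  have : ∑ e ∈ L, ((D.enterCount z e - 1 : ℕ) : ℤ) ≤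
      ∑ e ∈ L, ((D.enterCount y e - 1 : ℕ) : ℤ) :=
    Finset.sum_le_sum fun e _ => by have := he e; omega
  unfold dualValue
  linarith

/-- Discrete midpoint concavity of the dual objective. -/
theorem exists_balanced_pair [Fintype V] (D : MultiDigraph V E) {S : Set (Finset V)}
    {q : Finset V → ℤ} (hq : UncrossableOn NonCrossing S q) (L : Finset E)
    {y₀ y₁ : Multiset (Finset V)} (h₀ : ∀ Z ∈ y₀, Z ∈ S) (h₁ : ∀ Z ∈ y₁, Z ∈ S) :
    ∃ z₀ z₁ : Multiset (Finset V), (∀ Z ∈ z₀, Z ∈ S) ∧ (∀ Z ∈ z₁, Z ∈ S) ∧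
      D.dualValue L q y₀ + D.dualValue L q y₁ ≤ D.dualValue L q z₀ + D.dualValue L q z₁ ∧
      ∀ e, D.enterCount z₀ e + D.enterCount z₁ e ≤ D.enterCount y₀ e + D.enterCount y₁ e ∧
        D.enterCount z₀ e ≤ D.enterCount z₁ e + 1 ∧
        D.enterCount z₁ e ≤ D.enterCount z₀ e + 1 := by
  obtain ⟨z, hzS, hzC, hzq, hze⟩ := exists_uncrossed D
    (C := NonCrossing) (fun X Y h => h.elim Or.inl fun h => Or.inr (Or.inl h)) hq (y₀ + y₁)
    (fun Z hZ => (Multiset.mem_add.1 hZ).elim (h₀ Z) (h₁ Z))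
  obtain ⟨z₀, z₁, rfl, hz⟩ := exists_even_split D z hzC
  have hadd (e) : D.enterCount (y₀ + y₁) e = D.enterCount y₀ e + D.enterCount y₁ e :=
    Multiset.countP_add _ _ _
  refine ⟨z₀, z₁, fun Z hZ => hzS Z (Multiset.mem_add.2 (Or.inl hZ)),
    fun Z hZ => hzS Z (Multiset.mem_add.2 (Or.inr hZ)), ?_, fun e => ?_⟩
  · have hsum : ∑ e ∈ L, (((D.enterCount z₀ e - 1 : ℕ) : ℤ) + ((D.enterCount z₁ e - 1 : ℕ) : ℤ)) ≤
        ∑ e ∈ L, (((D.enterCount y₀ e - 1 : ℕ) : ℤ) + ((D.enterCount y₁ e - 1 : ℕ) : ℤ)) := by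
      refine Finset.sum_le_sum fun e _ => ?_
      have h1 := hz e
      have h2 := hze e
      have h3 := hadd e
      omega
    rw [Finset.sum_add_distrib, Finset.sum_add_distrib] at hsum
    simp only [Multiset.map_add, Multiset.sum_add] at hzq
    unfold dualValue
    linarith
  · have h1 := hz e
    have h2 := hze e
    have h3 := hadd e
    omega

theorem dualValue_insert [DecidableEq E] (D : MultiDigraph V E) {L : Finset E} {e : E}
    (he : e ∉ L) (q : Finset V → ℤ) (y : Multiset (Finset V)) :
    D.dualValue (insert e L) q y = D.dualValue L q y - ((D.enterCount y e - 1 : ℕ) : ℤ) := by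
  rw [dualValue, dualValue, Finset.sum_insert he]
  ring

theorem inDegree_insert [DecidableEq E] (D : MultiDigraph V E) {L : Finset E} {e : E}
    (he : e ∉ L) (Z : Finset V) :
    (D.inDegree (insert e L) Z : ℤ) = D.inDegree L Z + if D.Enters e Z then 1 else 0 := by
  rw [inDegree_eq_sum, inDegree_eq_sum, Finset.sum_insert he, add_comm]

/-- Forcing the edge `e` into the cover costs `y(e)` in the dual objective. -/
theorem dualValue_force (D : MultiDigraph V E) (L : Finset E) (e : E) (q : Finset V → ℤ)
    (y : Multiset (Finset V)) :
    D.dualValue L (fun Z => q Z - if D.Enters e Z then 1 else 0) y =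
      D.dualValue L q y - D.enterCount y e := by
  have : (y.map fun Z => q Z - if D.Enters e Z then (1 : ℤ) else 0).sum =
      (y.map q).sum - D.enterCount y e := by
    induction y using Multiset.induction_on with
    | empty => simp [enterCount]
    | cons A t ih =>
      rw [Multiset.map_cons, Multiset.sum_cons, ih, Multiset.map_cons, Multiset.sum_cons,
        enterCount_cons]
      push_cast
      ring
  rw [dualValue, dualValue, this]
  ring

/-- Adding a set `A` to a dual solution costs at most one for each edge entering `A`. -/
theorem dualValue_add_le_cons (D : MultiDigraph V E) (L : Finset E) (q : Finset V → ℤ)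
    (A : Finset V) (y : Multiset (Finset V)) :
    D.dualValue L q y + (q A - D.inDegree L A) ≤ D.dualValue L q (A ::ₘ y) := by
  have h : ∑ e ∈ L, ((D.enterCount (A ::ₘ y) e - 1 : ℕ) : ℤ) ≤
      ∑ e ∈ L, (((D.enterCount y e - 1 : ℕ) : ℤ) + if D.Enters e A then 1 else 0) := by
    refine Finset.sum_le_sum fun e _ => ?_
    rw [enterCount_cons]
    split_ifs <;> omega
  rw [Finset.sum_add_distrib, ← inDegree_eq_sum] at h
  rw [dualValue, dualValue, Multiset.map_cons, Multiset.sum_cons]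
  linarith

theorem dualValue_cons_of_mem (D : MultiDigraph V E) (L : Finset E) (q : Finset V → ℤ)
    {A : Finset V} {y : Multiset (Finset V)} (hA : A ∈ y) :
    D.dualValue L q (A ::ₘ y) = D.dualValue L q y + (q A - D.inDegree L A) := by
  have h : ∑ e ∈ L, ((D.enterCount (A ::ₘ y) e - 1 : ℕ) : ℤ) =
      ∑ e ∈ L, (((D.enterCount y e - 1 : ℕ) : ℤ) + if D.Enters e A then 1 else 0) := by
    refine Finset.sum_congr rfl fun e _ => ?_
    rw [enterCount_cons]
    split_ifs with hE
    · have : 0 < D.enterCount y e := Multiset.countP_pos.2 ⟨A, hA, hE⟩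
      omega
    · simp
  rw [Finset.sum_add_distrib, ← inDegree_eq_sum] at h
  rw [dualValue, dualValue, Multiset.map_cons, Multiset.sum_cons, h]
  ring

/-- If `L` covers `q`, repetitions in a dual solution are of no use. -/
theorem dualValue_le_dedup (D : MultiDigraph V E) (L : Finset E) (q : Finset V → ℤ)
    {y : Multiset (Finset V)} (hcov : ∀ Z ∈ y, q Z ≤ D.inDegree L Z) :
    D.dualValue L q y ≤ D.dualValue L q y.dedup := by
  obtain ⟨r, hr⟩ := Multiset.le_iff_exists_add.1 (Multiset.dedup_le y)
  have hmem : ∀ Z ∈ r, Z ∈ y := fun Z hZ => hr ▸ Multiset.mem_add.2 (Or.inr hZ)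
  rw [show D.dualValue L q y = D.dualValue L q (y.dedup + r) by rw [← hr]]
  clear hr
  induction r using Multiset.induction_on with
  | empty => simp
  | cons A t ih =>
    have hA := hmem A (Multiset.mem_cons_self A t)
    rw [Multiset.add_cons, dualValue_cons_of_mem]
    · have := hcov A hA
      have := ih fun Z hZ => hmem Z (Multiset.mem_cons_of_mem hZ)
      linarith
    · exact Multiset.mem_add.2 (Or.inl (Multiset.mem_dedup.2 hA))

/-! ### Strong duality -/

/-- Suppose that a dual solution `y₁` of value at least `d` has no member entered by `e`. If some
dual solution has value greater than `d` when `e` is disregarded, then some dual solution has value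
greater than `d` when `e` is taken into account. -/
theorem exists_dualValue_insert_lt [Fintype V] [DecidableEq E] (D : MultiDigraph V E)
    {S : Set (Finset V)} {q : Finset V → ℤ} (hq : UncrossableOn NonCrossing S q) {L : Finset E}
    {e : E} (he : e ∉ L) {d : ℤ} {y₀ y₁ : Multiset (Finset V)} (h₀ : ∀ Z ∈ y₀, Z ∈ S)
    (h₁ : ∀ Z ∈ y₁, Z ∈ S) (hy₁ : D.enterCount y₁ e = 0) (hd₁ : d ≤ D.dualValue L q y₁)
    (hd₀ : d < D.dualValue L q y₀) :
    ∃ y : Multiset (Finset V), (∀ Z ∈ y, Z ∈ S) ∧ d < D.dualValue (insert e L) q y := by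
  induction hn : D.enterCount y₀ e using Nat.strong_induction_on generalizing y₀ with
  | _ n ih =>
    by_cases hle : D.enterCount y₀ e ≤ 1
    · refine ⟨y₀, h₀, ?_⟩
      rw [dualValue_insert D he, Nat.sub_eq_zero_of_le hle]
      simpa using hd₀
    obtain ⟨z₀, z₁, hz₀, hz₁, hval, hbal⟩ := D.exists_balanced_pair hq L h₀ h₁
    have := hbal e
    -- The edge `e` enters fewer members of each half than of `y₀`, since `⌈n / 2⌉ < n` for `2 ≤ n`.
    by_cases hlt : d < D.dualValue L q z₀
    · exact ih _ (by omega) hz₀ hlt rfl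
    · exact ih _ (by omega) hz₁ (show d < D.dualValue L q z₁ by linarith) rfl

theorem UncrossableOn.force (D : MultiDigraph V E) {C : Finset V → Finset V → Prop}
    {S : Set (Finset V)} {q : Finset V → ℤ} (hq : UncrossableOn C S q) (e : E) :
    UncrossableOn C S fun Z => q Z - if D.Enters e Z then 1 else 0 := by
  intro X hX Y hY hXY
  obtain ⟨h1, h2, h3⟩ := hq X hX Y hY hXY
  refine ⟨h1, h2, ?_⟩
  have := D.enters_inter_union e X Y
  zify at this
  linarith

/-- Strong duality: some cover is at most as large as the value of some dual solution. -/
theorem exists_cover_le_dualValue [Fintype V] (D : MultiDigraph V E) {S : Set (Finset V)}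
    (L : Finset E) {q : Finset V → ℤ} (hq : UncrossableOn NonCrossing S q)
    (hcov : ∀ Z ∈ S, q Z ≤ D.inDegree L Z) :
    ∃ X ⊆ L, (∀ Z ∈ S, q Z ≤ D.inDegree X Z) ∧ ∃ y : Multiset (Finset V), (∀ Z ∈ y, Z ∈ S) ∧
      (X.card : ℤ) ≤ D.dualValue L q y := by
  classical
  induction L using Finset.induction_on generalizing q with
  | empty => exact ⟨∅, subset_rfl, hcov, 0, by simp, by simp [dualValue]⟩
  | insert e L he ih =>
    obtain ⟨X₁, hX₁L, hX₁, y₁, hy₁S, hy₁⟩ := ih (UncrossableOn.force D hq e) (fun Z hZ => by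
      have := hcov Z hZ
      rw [inDegree_insert D he] at this
      linarith)
    have heX₁ : e ∉ X₁ := fun h => he (hX₁L h)
    have hforced : ∀ Z ∈ S, q Z ≤ D.inDegree (insert e X₁) Z := fun Z hZ => by
      have := hX₁ Z hZ
      rw [inDegree_insert D heX₁]
      linarith
    have hcard : ((insert e X₁).card : ℤ) = X₁.card + 1 := by
      rw [Finset.card_insert_of_notMem heX₁]
      push_cast
      rfl
    rw [dualValue_force] at hy₁
    by_cases hbig : ∃ y : Multiset (Finset V), (∀ Z ∈ y, Z ∈ S) ∧
        (X₁.card : ℤ) < D.dualValue (insert e L) q y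
    · obtain ⟨y, hyS, hy⟩ := hbig
      exact ⟨insert e X₁, Finset.insert_subset_insert e hX₁L, hforced, y, hyS, by omega⟩
    have hzero : D.enterCount y₁ e = 0 := by
      by_contra h
      refine hbig ⟨y₁, hy₁S, ?_⟩
      rw [dualValue_insert D he]
      omega
    have hd₁ : (X₁.card : ℤ) ≤ D.dualValue L q y₁ := by simpa [hzero] using hy₁
    have hsmall : ∀ y : Multiset (Finset V), (∀ Z ∈ y, Z ∈ S) →
        D.dualValue L q y ≤ X₁.card := fun y hyS => by
      by_contra! h
      exact hbig (D.exists_dualValue_insert_lt hq he hyS hy₁S hzero hd₁ h)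
    by_cases hdel : ∀ Z ∈ S, q Z ≤ D.inDegree L Z
    · obtain ⟨X₀, hX₀L, hX₀, y₀, hy₀S, hy₀⟩ := ih hq hdel
      refine ⟨X₀, hX₀L.trans (Finset.subset_insert e L), hX₀, y₁, hy₁S, ?_⟩
      rw [dualValue_insert D he, hzero]
      have := hsmall y₀ hy₀S
      simp only [Nat.zero_sub, Nat.cast_zero, sub_zero]
      linarith
    -- If `e` cannot be deleted, a set `Z` witnessing this improves the dual solution `y₁`.
    · push Not at hdel
      obtain ⟨Z, hZ, hlt⟩ := hdel
      have h1 := D.dualValue_add_le_cons L q Z y₁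
      have h2 := hsmall (Z ::ₘ y₁) (fun W hW =>
        (Multiset.mem_cons.1 hW).elim (fun h => h ▸ hZ) (hy₁S W))
      linarith

/-- Weak duality. -/
theorem familyValue_le_card [Fintype E] (D : MultiDigraph V E) {p : Finset V → WithBot ℤ}
    {X : Finset E} (hX : D.Covers X p) {F : Finset (Finset V)} (hF : ∀ Z ∈ F, p Z ≠ ⊥) :
    D.familyValue p F ≤ X.card := by
  classical
  have hp : ∀ Z ∈ F, (p Z).unbotD 0 ≤ D.inDegree X Z := fun Z hZ => by
    have h := hX Z
    obtain ⟨a, ha⟩ := WithBot.ne_bot_iff_exists.1 (hF Z hZ)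
    rw [← ha] at h ⊢
    simpa using h
  have hsplit (Z : Finset V) :
      (D.inDegree Finset.univ Z : ℤ) = D.inDegree X Z + D.inDegree Xᶜ Z := by
    rw [inDegree_eq_sum, inDegree_eq_sum, inDegree_eq_sum, Finset.sum_add_sum_compl]
  -- An edge outside `X` entering the family is counted in the slack of some member.
  have hdeg : D.familyInDegree Finset.univ F ≤ X.card + ∑ Z ∈ F, D.inDegree Xᶜ Z := by
    refine (Finset.card_le_card (t := X ∪ F.biUnion fun Z => Xᶜ.filter (D.Enters · Z)) ?_).trans
      ((Finset.card_union_le _ _).trans (Nat.add_le_add_left Finset.card_biUnion_le _))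
    intro e he
    obtain ⟨Z, hZ, heZ⟩ := (Finset.mem_filter.1 he).2
    by_cases heX : e ∈ X
    · exact Finset.mem_union_left _ heX
    · exact Finset.mem_union_right _ (Finset.mem_biUnion.2
        ⟨Z, hZ, Finset.mem_filter.2 ⟨Finset.mem_compl.2 heX, heZ⟩⟩)
  have hslack : ∑ Z ∈ F, (D.inDegree Xᶜ Z : ℤ) ≤
      ∑ Z ∈ F, ((D.inDegree Finset.univ Z : ℤ) - (p Z).unbotD 0) :=
    Finset.sum_le_sum fun Z hZ => by
      have := hp Z hZ
      rw [hsplit]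
      linarith
  zify at hdeg
  unfold familyValue
  linarith

theorem familyValue_eq_dualValue [Fintype E] (D : MultiDigraph V E) (p : Finset V → WithBot ℤ)
    (F : Finset (Finset V)) :
    D.familyValue p F = D.dualValue Finset.univ (fun Z => (p Z).unbotD 0) F.val := by
  have hcount (e : E) : (D.enterCount F.val e : ℤ) = ∑ Z ∈ F, if D.Enters e Z then 1 else 0 := by
    rw [Finset.sum_boole, enterCount, Multiset.countP_eq_card_filter]
    rfl
  have hdeg : ∑ Z ∈ F, (D.inDegree Finset.univ Z : ℤ) = ∑ e, (D.enterCount F.val e : ℤ) := by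
    simp only [inDegree_eq_sum, hcount]
    exact Finset.sum_comm
  have hfam : (D.familyInDegree Finset.univ F : ℤ) =
      ∑ e, ((D.enterCount F.val e : ℤ) - ((D.enterCount F.val e - 1 : ℕ) : ℤ)) := by
    rw [familyInDegree, Finset.natCast_card_filter]
    refine Finset.sum_congr rfl fun e _ => ?_
    have hpos : (∃ Z ∈ F, D.Enters e Z) ↔ 0 < D.enterCount F.val e :=
      Multiset.countP_pos.symm
    rw [if_congr hpos rfl rfl]
    split_ifs <;> omega
  rw [Finset.sum_sub_distrib] at hfam
  rw [familyValue, dualValue, Finset.sum_sub_distrib, hdeg, hfam]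
  show _ = ∑ Z ∈ F, (p Z).unbotD 0 - _
  ring

/-- A dual solution yields a family of distinct, pairwise `C`-related sets of at least its value,
where `C` is any relation outside of which `p` is supermodular. -/
theorem exists_family_of_dualValue [Fintype V] [Fintype E] (D : MultiDigraph V E)
    {p : Finset V → WithBot ℤ} (hcov : D.Covers Finset.univ p)
    {C : Finset V → Finset V → Prop} (hC : ∀ X Y, X ⊆ Y ∨ Y ⊆ X → C X Y)
    (hp : UncrossableOn C {Z | p Z ≠ ⊥} fun Z => (p Z).unbotD 0)
    {y : Multiset (Finset V)} (hy : ∀ Z ∈ y, p Z ≠ ⊥) :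
    ∃ F : Finset (Finset V), (∀ X ∈ F, ∀ Y ∈ F, C X Y) ∧ (∀ Z ∈ F, p Z ≠ ⊥) ∧
      D.dualValue Finset.univ (fun Z => (p Z).unbotD 0) y ≤ D.familyValue p F := by
  obtain ⟨z, hzS, hzC, hzq, hze⟩ := exists_uncrossed D hC hp y hy
  refine ⟨z.toFinset, fun X hX Y hY => hzC X (Multiset.mem_toFinset.1 hX) Y
    (Multiset.mem_toFinset.1 hY), fun Z hZ => hzS Z (Multiset.mem_toFinset.1 hZ), ?_⟩
  rw [familyValue_eq_dualValue]
  refine (dualValue_mono Finset.univ hzq hze).trans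
    (D.dualValue_le_dedup Finset.univ _ fun Z hZ => ?_)
  have h := hcov Z
  obtain ⟨a, ha⟩ := WithBot.ne_bot_iff_exists.1 (hzS Z hZ)
  rw [← ha] at h ⊢
  simpa using h

theorem uncrossableOn_unbotD {p : Finset V → WithBot ℤ} {C : Finset V → Finset V → Prop}
    (h : ∀ X Y, ¬ C X Y → p X + p Y ≤ p (X ∩ Y) + p (X ∪ Y)) :
    UncrossableOn C {Z | p Z ≠ ⊥} fun Z => (p Z).unbotD 0 := by
  intro X hX Y hY hXY
  have hle := h X Y hXY
  obtain ⟨a, ha⟩ := WithBot.ne_bot_iff_exists.1 hX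
  obtain ⟨b, hb⟩ := WithBot.ne_bot_iff_exists.1 hY
  rw [← ha, ← hb, ← WithBot.coe_add] at hle
  have hne : p (X ∩ Y) + p (X ∪ Y) ≠ ⊥ := ne_bot_of_le_ne_bot (WithBot.coe_ne_bot) hle
  obtain ⟨hI, hU⟩ := WithBot.add_ne_bot.1 hne
  refine ⟨hI, hU, ?_⟩
  obtain ⟨c, hc⟩ := WithBot.ne_bot_iff_exists.1 hI
  obtain ⟨d, hd⟩ := WithBot.ne_bot_iff_exists.1 hU
  rw [← hc, ← hd, ← WithBot.coe_add, WithBot.coe_le_coe] at hle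
  simpa [← ha, ← hb, ← hc, ← hd] using hle

end MultiDigraph

open MultiDigraph in
theorem mainTheorem8 {V E : Type*} [Fintype V] [DecidableEq V] [Fintype E]
    (D : MultiDigraph V E) (p : Finset V → WithBot ℤ)
    (hp : IntersectingSupermodular p) (hcov : D.Covers Finset.univ p) :
    ∃ k : ℕ,
      IsLeast {n : ℕ | ∃ X : Finset E, D.Covers X p ∧ X.card = n} k ∧
      IsGreatest {v : ℤ | ∃ F : Finset (Finset V),
        LaminarFamily F ∧ (∀ Z ∈ F, p Z ≠ ⊥) ∧ D.familyValue p F = v} (k : ℤ) ∧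
      (FullySupermodular p → ∃ C : Finset (Finset V),
        IsChain (· ⊆ ·) (C : Set (Finset V)) ∧ (∀ Z ∈ C, p Z ≠ ⊥) ∧
          D.familyValue p C = (k : ℤ)) := by
  have hcovers (X : Finset E) : D.Covers X p ↔
      ∀ Z ∈ {Z | p Z ≠ ⊥}, (p Z).unbotD 0 ≤ (D.inDegree X Z : ℤ) := by
    refine forall_congr' fun Z => ?_
    cases h : p Z <;> simp [h]
  have hlam : UncrossableOn NonCrossing {Z | p Z ≠ ⊥} fun Z => (p Z).unbotD 0 :=
    uncrossableOn_unbotD fun X Y hXY => hp X Y <| by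
      rw [← Finset.not_disjoint_iff_nonempty_inter]
      exact fun h => hXY (Or.inr (Or.inr h))
  obtain ⟨X, -, hX, y, hyS, hy⟩ :=
    D.exists_cover_le_dualValue Finset.univ hlam ((hcovers _).1 hcov)
  rw [← hcovers] at hX
  obtain ⟨F, hF, hFp, hFv⟩ := D.exists_family_of_dualValue hcov
    (fun X Y h => h.elim Or.inl fun h => Or.inr (Or.inl h)) hlam hyS
  have hFX : D.familyValue p F = X.card :=
    le_antisymm (D.familyValue_le_card hX hFp) (hy.trans hFv)
  refine ⟨X.card, ⟨⟨X, hX, rfl⟩, ?_⟩, ⟨⟨F, hF, hFp, hFX⟩, ?_⟩, fun hfull => ?_⟩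
  · rintro n ⟨X', hX', rfl⟩
    have := D.familyValue_le_card hX' hFp
    rw [hFX] at this
    exact_mod_cast this
  · rintro v ⟨G, -, hG, rfl⟩
    exact D.familyValue_le_card hX hG
  · obtain ⟨G, hG, hGp, hGv⟩ := D.exists_family_of_dualValue hcov
      (C := fun X Y => X ⊆ Y ∨ Y ⊆ X) (fun X Y h => h)
      (uncrossableOn_unbotD fun X Y _ => hfull X Y) hyS
    exact ⟨G, fun X hX Y hY _ => hG X hX Y hY, hGp,
      le_antisymm (D.familyValue_le_card hX hGp) (hy.trans hGv)⟩
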